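/- An instance of size $n$ is a set $U$ with $|U|=n$ and a weight function $w:U\to[0,\infty)$ with $W=\sum_{a\in U}w(a)>0$. An algorithm in the proportional setting is randomized (with arbitrary private randomness) and adaptive, and interacts with the instance only by (1) drawing a proportional sample, independent of the previous ones: an item is drawn that equals $a\in U$ with probability $w(a)/W$, and the algorithm is told its weight $w(a)$; (2) testing whether two of the items drawn so far are the same item. At some point it may stop and return a real number $\hat W$; this is a $(1\pm\varepsilon)$-approximation of $W$ if $(1-\varepsilon)W\le\hat W\le(1+\varepsilon)W$. Only samples are counted. **Theorem.** Let $\varepsilon_0<1$ be a constant and let $m(n,\varepsilon)=o(\sqrt n/\varepsilon)$ as $n\to\infty$, uniformly over $0<\varepsilon\le\varepsilon_0$. Then there is $n_0$ such that for all $n\ge n_0$ and all $0<\varepsilon\le\varepsilon_0$ there is no algorithm in the proportional setting (even one that is designed for these values of $n$ and $\varepsilon$, so that it knows $n$) which on every instance of size $n$ almost surely takes at most $m(n,\varepsilon)$ samples and returns a $(1\pm\varepsilon)$-approximation of $W$ with probability at least $2/3$. The same holds if the algorithm is only required to take at most $m(n,\varepsilon)$ samples in expectation on every instance of size $n$. 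-/

import Mathlib

open MeasureTheory Filter Asymptotics
open scoped ENNReal Topology

/-! Sum estimation by proportional sampling: instances, the interaction model, sample counts. -/

/-- An instance of size `n`: a set of `n` items with nonnegative weights, not all zero
(so that proportional sampling makes sense). -/
structure SumInstance (n : ℕ) where
  w : Fin n → ℝ
  nonneg : ∀ a, 0 ≤ w a
  total_pos : 0 < ∑ a, w a

namespace SumInstance

variable {n : ℕ} (I : SumInstance n)

/-- The total weight `W`. -/
def total : ℝ := ∑ a, I.w a

/-- The law of one proportional sample: item `a` has probability `w a / W`. -/
noncomputable def samplePMF : PMF (Fin n) :=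
  PMF.ofFintype (fun a => ENNReal.ofReal (I.w a / I.total)) (by
    have h : 0 < I.total := I.total_pos
    rw [← ENNReal.ofReal_sum_of_nonneg (fun a _ => div_nonneg (I.nonneg a) h.le),
      ← Finset.sum_div]
    change ENNReal.ofReal (I.total / I.total) = 1
    rw [div_self h.ne', ENNReal.ofReal_one])

/-- The law of an infinite sequence of independent proportional samples. -/
noncomputable def sampleSeq : Measure (ℕ → Fin n) :=
  Measure.infinitePi (fun _ : ℕ => I.samplePMF.toMeasure)

end SumInstance

/-- What an algorithm can do next: draw a proportional sample, test whether the items drawn as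
sample number `i` and as sample number `j` (counted from `0`) are the same item, or stop with an
estimate. -/
inductive PropAction where
  | sample : PropAction
  | compare (i j : ℕ) : PropAction
  | output (v : ℝ) : PropAction

namespace PropAction

def toSum : PropAction → Unit ⊕ (ℕ × ℕ) ⊕ ℝ
  | sample => Sum.inl ()
  | compare i j => Sum.inr (Sum.inl (i, j))
  | output v => Sum.inr (Sum.inr v)

instance : MeasurableSpace PropAction := MeasurableSpace.comap toSum inferInstance

end PropAction

/-- What an algorithm is told: the weight of the item just drawn, or the outcome of a comparison.
The item itself is never revealed. -/
inductive PropAnswer where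
  | weight (r : ℝ) : PropAnswer
  | same (b : Bool) : PropAnswer

/-- A randomized adaptive algorithm in the proportional setting whose private randomness is a
seed in `Ω`: from the seed and the list of all answers received so far it chooses the next
action. -/
structure PropAlgorithm (Ω : Type*) [MeasurableSpace Ω] where
  act : Ω → List PropAnswer → PropAction
  measurable_act : ∀ h, Measurable fun ω => act ω h

/-- The state of a run: number of samples drawn, answers received, and the output, if any. -/
structure PropState where
  count : ℕ
  hist : List PropAnswer
  out : Option ℝ

namespace PropAlgorithm

variable {Ω : Type*} [MeasurableSpace Ω] {n : ℕ}

/-- One step of the run with seed `ω` when the successive samples are `x 0, x 1, …`. A comparison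
that mentions an item not drawn yet is answered `false`. -/
noncomputable def step (A : PropAlgorithm Ω) (I : SumInstance n) (ω : Ω) (x : ℕ → Fin n)
    (s : PropState) : PropState :=
  match s.out with
  | some _ => s
  | none =>
    match A.act ω s.hist with
    | .sample => ⟨s.count + 1, s.hist ++ [.weight (I.w (x s.count))], none⟩
    | .compare i j =>
        ⟨s.count, s.hist ++ [.same (decide (i < s.count ∧ j < s.count ∧ x i = x j))], none⟩
    | .output v => ⟨s.count, s.hist, some v⟩

/-- The state after `t` steps. -/
noncomputable def run (A : PropAlgorithm Ω) (I : SumInstance n) (ω : Ω) (x : ℕ → Fin n)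
    (t : ℕ) : PropState :=
  (A.step I ω x)^[t] ⟨0, [], none⟩

/-- The total number of samples drawn (`∞` if the algorithm samples forever). -/
noncomputable def sampleCount (A : PropAlgorithm Ω) (I : SumInstance n) (ω : Ω)
    (x : ℕ → Fin n) : ℝ≥0∞ :=
  ⨆ t, ((A.run I ω x t).count : ℝ≥0∞)

/-- The algorithm halts and its output is a `(1 ± ε)`-approximation of the total weight. -/
def Succeeds (A : PropAlgorithm Ω) (I : SumInstance n) (ε : ℝ) (ω : Ω) (x : ℕ → Fin n) : Prop :=
  ∃ t v, (A.run I ω x t).out = some v ∧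
    (1 - ε) * I.total ≤ v ∧ v ≤ (1 + ε) * I.total

/-- On every instance of size `n` the algorithm returns a `(1 ± ε)`-approximation of the total
weight with probability at least `2/3`, over the seed and the samples. -/
def Approximates (A : PropAlgorithm Ω) (μ : Measure Ω) (n : ℕ) (ε : ℝ) : Prop :=
  ∀ I : SumInstance n, 2 / 3 ≤ (μ.prod I.sampleSeq) {p | A.Succeeds I ε p.1 p.2}

/-- On every instance of size `n` the algorithm draws at most `m` samples, almost surely. -/
def WorstCaseSamplesLE (A : PropAlgorithm Ω) (μ : Measure Ω) (n : ℕ) (m : ℝ) : Prop :=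
  ∀ I : SumInstance n,
    ∀ᵐ p ∂(μ.prod I.sampleSeq), A.sampleCount I p.1 p.2 ≤ ENNReal.ofReal m

/-- On every instance of size `n` the expected number of samples drawn is at most `m`. -/
def ExpectedSamplesLE (A : PropAlgorithm Ω) (μ : Measure Ω) (n : ℕ) (m : ℝ) : Prop :=
  ∀ I : SumInstance n,
    ∫⁻ p, A.sampleCount I p.1 p.2 ∂(μ.prod I.sampleSeq) ≤ ENNReal.ofReal m

end PropAlgorithm

/-!
Le Cam's method. Delete random items of an instance `I`, in such a way that the total weight drops
by more than a factor `(1 - ε) / (1 + ε)`; call the result `J f`, where `f` is the random choice.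
An algorithm that halts within `s` samples cannot tell `I` from the mixture of the `J f` when the
`χ²`-divergence between the laws of `s` samples is small. Since the remaining weights do not change,
one plus this divergence is the mean of `correlation I (J f) (J f') ^ s` over independent `f`, `f'`.

The instance `I` consists of `N` blocks of `b` items of weight `1` and of a heavy item, and `f`
selects the set of surviving items independently in each block. These sets all have the same size,
so that the total weight of `J f` is constant and the correlation depends only on the number of
blocks in which `f` and `f'` agree. When `ε` is bounded away from `0`, the block size is constant
and one item of each block survives; for small `ε` one item of each block is deleted, with `b` of
order `1 / ε`. The correlation then deviates from `1` by about `1 / (b √n)`, which takes about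
`√n / ε` samples to notice. Blocks larger than `√n` are useless, as a missing item would be noticed
within `n` samples; for `ε` below `1 / √n` the heavy item dilutes the deleted weight instead.
-/

theorem PropAction.measurable_of_output {α : Type*} [MeasurableSpace α] {f : PropAction → α}
    (hf : Measurable fun v => f (.output v)) : Measurable f := by
  let g : Unit ⊕ (ℕ × ℕ) ⊕ ℝ → α :=
    Sum.elim (fun _ => f .sample) (Sum.elim (fun q => f (.compare q.1 q.2)) fun v => f (.output v))
  have hg : Measurable g :=
    .sumElim measurable_const (.sumElim (Measurable.of_discrete) hf)
  have hfg : f = g ∘ PropAction.toSum := by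
    funext a
    cases a <;> rfl
  rw [hfg]
  exact hg.comp (comap_measurable _)

/-- The `σ`-algebra on states in which a set is measurable as soon as it is measurable in the
output, once the sample count and the answers are fixed. -/
instance : MeasurableSpace PropState :=
  ⨅ (c : ℕ) (h : List PropAnswer), MeasurableSpace.map (fun v : ℝ => ⟨c, h, some v⟩) inferInstance

theorem PropState.measurableSet_iff {P : Set PropState} :
    MeasurableSet P ↔ ∀ c h, MeasurableSet {v : ℝ | ⟨c, h, some v⟩ ∈ P} := by
  simp only [MeasurableSpace.measurableSet_iInf]
  rfl

theorem PropState.measurableSet_singleton_of_out_eq_none {σ : PropState} (hσ : σ.out = none) :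
    MeasurableSet {σ} := by
  refine PropState.measurableSet_iff.2 fun c h => ?_
  convert MeasurableSet.empty using 1
  ext v
  simp only [Set.mem_ofPred_eq, Set.mem_singleton_iff, Set.mem_empty_iff_false, iff_false]
  rintro rfl
  simp at hσ

theorem PropState.measurableSet_out_ne_none : MeasurableSet {σ : PropState | σ.out ≠ none} :=
  PropState.measurableSet_iff.2 fun c h => by simp

theorem PropState.measurable_count : Measurable PropState.count := fun s _ =>
  PropState.measurableSet_iff.2 fun c _ => MeasurableSet.const (c ∈ s)

/-- The answers that an algorithm may receive on the instance `I`. -/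
def SumInstance.answers {n : ℕ} (I : SumInstance n) : Set PropAnswer :=
  Set.range (fun a => .weight (I.w a)) ∪ Set.range .same

theorem SumInstance.countable_live_states {n : ℕ} (I : SumInstance n) :
    {σ : PropState | σ.out = none ∧ ∀ a ∈ σ.hist, a ∈ I.answers}.Countable := by
  have hA : Countable I.answers :=
    ((Set.countable_range _).union (Set.countable_range _)).to_subtype
  refine (Set.countable_range fun q : ℕ × List I.answers =>
    (⟨q.1, q.2.map (↑), none⟩ : PropState)).mono ?_
  rintro ⟨c, h, o⟩ ⟨rfl : o = none, hh : ∀ a ∈ h, a ∈ I.answers⟩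
  lift h to List I.answers using hh
  exact ⟨(c, h), rfl⟩

namespace PropAlgorithm

section Run

variable {Ω : Type*} [MeasurableSpace Ω] {n : ℕ} (A : PropAlgorithm Ω) (I : SumInstance n)

theorem run_succ (ω : Ω) (x : ℕ → Fin n) (t : ℕ) :
    A.run I ω x (t + 1) = A.step I ω x (A.run I ω x t) :=
  Function.iterate_succ_apply' _ _ _

theorem count_le_count_step (ω : Ω) (x : ℕ → Fin n) (σ : PropState) :
    σ.count ≤ (A.step I ω x σ).count := by
  unfold step
  split
  · exact le_rfl
  · split <;> simp

theorem count_step_le (ω : Ω) (x : ℕ → Fin n) (σ : PropState) :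
    (A.step I ω x σ).count ≤ σ.count + 1 := by
  unfold step
  split
  · simp
  · split <;> simp

theorem count_run_le (ω : Ω) (x : ℕ → Fin n) (t : ℕ) : (A.run I ω x t).count ≤ t := by
  induction t with
  | zero => exact le_rfl
  | succ t ih =>
    rw [run_succ]
    exact (A.count_step_le I ω x _).trans (by gcongr)

theorem step_eq_self_of_out {σ : PropState} (h : σ.out ≠ none) (ω : Ω) (x : ℕ → Fin n) :
    A.step I ω x σ = σ := by
  obtain ⟨v, hv⟩ := Option.ne_none_iff_exists'.1 h
  simp only [step, hv]

theorem hist_step_subset_answers {ω : Ω} {x : ℕ → Fin n} {σ : PropState}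
    (h : ∀ a ∈ σ.hist, a ∈ I.answers) : ∀ a ∈ (A.step I ω x σ).hist, a ∈ I.answers := by
  unfold step
  split
  · exact h
  · split
    · exact List.forall_mem_append.2 ⟨h, List.forall_mem_singleton.2 (.inl ⟨_, rfl⟩)⟩
    · exact List.forall_mem_append.2 ⟨h, List.forall_mem_singleton.2 (.inr ⟨_, rfl⟩)⟩
    · exact h

theorem hist_run_subset_answers (ω : Ω) (x : ℕ → Fin n) (t : ℕ) :
    ∀ a ∈ (A.run I ω x t).hist, a ∈ I.answers := by
  induction t with
  | zero => exact fun a ha => absurd ha List.not_mem_nil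
  | succ t ih =>
    rw [run_succ]
    exact A.hist_step_subset_answers I ih

variable {A I} in
theorem run_eq_of_out {ω : Ω} {x : ℕ → Fin n} {t t' : ℕ} (htt' : t ≤ t')
    (h : (A.run I ω x t).out ≠ none) : A.run I ω x t' = A.run I ω x t := by
  induction t', htt' using Nat.le_induction with
  | base => rfl
  | succ k _ ih => rw [run_succ, ih, step_eq_self_of_out A I h]

variable {A I} in
theorem out_run_unique {ω : Ω} {x : ℕ → Fin n} {t t' : ℕ} {v v' : ℝ}
    (h : (A.run I ω x t).out = some v) (h' : (A.run I ω x t').out = some v') : v = v' := by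
  have key := run_eq_of_out (le_max_left t t') (h ▸ Option.some_ne_none v)
  rw [run_eq_of_out (le_max_right t t') (h' ▸ Option.some_ne_none v')] at key
  rw [← Option.some_inj, ← h, ← h', key]

variable {A I} in
theorem step_congr {I' : SumInstance n} {ω : Ω} {x x' : ℕ → Fin n} {σ : PropState}
    (hx : ∀ i < (A.step I ω x σ).count, x i = x' i)
    (hw : ∀ i < (A.step I ω x σ).count, I.w (x i) = I'.w (x i)) :
    A.step I ω x σ = A.step I' ω x' σ := by
  unfold step at hx hw ⊢
  split
  · rfl
  · rename_i h
    rw [h] at hx hw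
    split
    · rename_i ha
      simp only [ha] at hx hw
      rw [hw _ (Nat.lt_succ_self _), hx _ (Nat.lt_succ_self _)]
    · rename_i i j ha
      simp only [ha] at hx
      have hij : (i < σ.count ∧ j < σ.count ∧ x i = x j) ↔
          (i < σ.count ∧ j < σ.count ∧ x' i = x' j) := by
        refine and_congr_right fun hi => and_congr_right fun hj => ?_
        rw [hx i hi, hx j hj]
      simp only [hij]
    · rfl

variable {A I} in
theorem run_congr {I' : SumInstance n} {ω : Ω} {x x' : ℕ → Fin n} {t : ℕ}
    (hx : ∀ i < (A.run I ω x t).count, x i = x' i)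
    (hw : ∀ i < (A.run I ω x t).count, I.w (x i) = I'.w (x i)) :
    A.run I ω x t = A.run I' ω x' t := by
  induction t with
  | zero => rfl
  | succ t ih =>
    rw [run_succ] at hx hw
    have hcount := A.count_le_count_step I ω x (A.run I ω x t)
    rw [run_succ, run_succ, step_congr hx hw,
      ih (fun i hi => hx i (hi.trans_le hcount)) fun i hi => hw i (hi.trans_le hcount)]

theorem dependsOn_run (ω : Ω) (t : ℕ) :
    DependsOn (fun x => A.run I ω x t) (Set.Iio t) := fun x _ hx =>
  run_congr (fun i hi => hx i (hi.trans_le (A.count_run_le I ω x t))) fun _ _ => rfl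

theorem lt_sampleCount_iff {s : ℕ} {ω : Ω} {x : ℕ → Fin n} :
    s < A.sampleCount I ω x ↔ ∃ t, s < (A.run I ω x t).count := by
  simp only [sampleCount, lt_iSup_iff, Nat.cast_lt]

theorem count_run_le_sampleCount {ω : Ω} {x : ℕ → Fin n} (t : ℕ) :
    ((A.run I ω x t).count : ℝ≥0∞) ≤ A.sampleCount I ω x :=
  le_iSup (fun t => ((A.run I ω x t).count : ℝ≥0∞)) t

/-- The algorithm halts after at most `s` samples and its output lies in `R`. -/
def HaltsWithin (s : ℕ) (R : Set ℝ) (ω : Ω) (x : ℕ → Fin n) : Prop :=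
  ∃ t, ∃ v ∈ R, (A.run I ω x t).out = some v ∧ (A.run I ω x t).count ≤ s

variable {A I}

theorem HaltsWithin.congr {I' : SumInstance n} {s : ℕ} {R : Set ℝ} {ω : Ω} {x x' : ℕ → Fin n}
    (h : A.HaltsWithin I s R ω x) (hx : ∀ i < s, x i = x' i)
    (hw : ∀ i < s, I.w (x i) = I'.w (x i)) : A.HaltsWithin I' s R ω x' := by
  obtain ⟨t, v, hv, hout, hcount⟩ := h
  refine ⟨t, v, hv, ?_⟩
  rw [← run_congr (fun i hi => hx i (hi.trans_le hcount)) fun i hi => hw i (hi.trans_le hcount)]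
  exact ⟨hout, hcount⟩

theorem dependsOn_haltsWithin (s : ℕ) (R : Set ℝ) (ω : Ω) :
    DependsOn (A.HaltsWithin I s R ω) (Set.Iio s) := fun _ _ hx =>
  propext ⟨fun h => h.congr hx fun _ _ => rfl,
    fun h => h.congr (fun i hi => (hx i hi).symm) fun _ _ => rfl⟩

theorem Succeeds.haltsWithin_or_lt_sampleCount {ε : ℝ} {ω : Ω} {x : ℕ → Fin n}
    (h : A.Succeeds I ε ω x) {R : Set ℝ}
    (hR : Set.Icc ((1 - ε) * I.total) ((1 + ε) * I.total) ⊆ R) (s : ℕ) :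
    A.HaltsWithin I s R ω x ∨ s < A.sampleCount I ω x := by
  obtain ⟨t, v, hout, hv⟩ := h
  rcases le_or_gt (A.run I ω x t).count s with hcount | hcount
  · exact .inl ⟨t, v, hR hv, hout, hcount⟩
  · exact .inr ((A.lt_sampleCount_iff I).2 ⟨t, hcount⟩)

theorem Succeeds.not_haltsWithin {ε : ℝ} {ω : Ω} {x : ℕ → Fin n} (h : A.Succeeds I ε ω x)
    {R : Set ℝ} (hR : Disjoint (Set.Icc ((1 - ε) * I.total) ((1 + ε) * I.total)) R) (s : ℕ) :
    ¬ A.HaltsWithin I s R ω x := by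
  rintro ⟨t', v', hv', hout', -⟩
  obtain ⟨t, v, hout, hv⟩ := h
  exact hR.notMem_of_mem_left hv (out_run_unique hout hout' ▸ hv')

end Run

section Measurability

variable {Ω : Type*} [MeasurableSpace Ω] {n : ℕ} (A : PropAlgorithm Ω) (I : SumInstance n)

theorem measurable_step (x : ℕ → Fin n) (σ : PropState) :
    Measurable fun ω => A.step I ω x σ := by
  obtain ⟨c, h, _ | v⟩ := σ
  · let next : PropAction → PropState
      | .sample => ⟨c + 1, h ++ [.weight (I.w (x c))], none⟩
      | .compare i j => ⟨c, h ++ [.same (decide (i < c ∧ j < c ∧ x i = x j))], none⟩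
      | .output v => ⟨c, h, some v⟩
    have h_next : Measurable next := PropAction.measurable_of_output fun P hP =>
      PropState.measurableSet_iff.1 hP c h
    exact h_next.comp (A.measurable_act h)
  · exact measurable_const

theorem measurable_run (x : ℕ → Fin n) (t : ℕ) : Measurable fun ω => A.run I ω x t := by
  induction t with
  | zero => exact measurable_const
  | succ t ih =>
    intro P hP
    -- The seed is consulted at uncountably many histories, but only countably many can occur.
    have h_split : (fun ω => A.run I ω x (t + 1)) ⁻¹' P =
        (fun ω => A.run I ω x t) ⁻¹' (P ∩ {σ | σ.out ≠ none}) ∪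
          ⋃ σ ∈ {σ : PropState | σ.out = none ∧ ∀ a ∈ σ.hist, a ∈ I.answers},
            (fun ω => A.run I ω x t) ⁻¹' {σ} ∩ (fun ω => A.step I ω x σ) ⁻¹' P := by
      ext ω
      have h_hist := A.hist_run_subset_answers I ω x t
      simp only [Set.mem_preimage, Set.mem_union, Set.mem_iUnion, Set.mem_inter_iff, run_succ,
        Set.mem_ofPred_eq, Set.mem_singleton_iff, exists_prop]
      by_cases h_out : (A.run I ω x t).out = none
      · simp only [h_out, ne_eq, not_true_eq_false, and_false, false_or]
        exact ⟨fun h => ⟨_, ⟨h_out, h_hist⟩, rfl, h⟩, fun ⟨_, _, hσ, h⟩ => hσ ▸ h⟩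
      · have : ∀ σ : PropState, σ.out = none → A.run I ω x t ≠ σ :=
          fun σ hσ h => h_out (h ▸ hσ)
        rw [step_eq_self_of_out A I h_out]
        grind
    rw [h_split]
    refine (ih (hP.inter PropState.measurableSet_out_ne_none)).union
      (.biUnion I.countable_live_states fun σ hσ => ?_)
    exact (ih (PropState.measurableSet_singleton_of_out_eq_none hσ.1)).inter
      (A.measurable_step I x σ hP)

end Measurability

end PropAlgorithm

/-- The sequence that starts with `z` and continues with the item `a`. -/
noncomputable def extendBy {α : Type*} {s : ℕ} (a : α) (z : Fin s → α) : ℕ → α :=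
  Function.extend Fin.val z fun _ => a

theorem extendBy_apply_val {α : Type*} {s : ℕ} (a : α) (z : Fin s → α) (i : Fin s) :
    extendBy a z i = z i :=
  Fin.val_injective.extend_apply z _ i

theorem extendBy_val_apply_of_lt {α : Type*} {s i : ℕ} (hi : i < s) (a : α) (x : ℕ → α) :
    extendBy a (fun j : Fin s => x j) i = x i :=
  extendBy_apply_val a (fun j : Fin s => x j) ⟨i, hi⟩

theorem eq_extendBy_of_dependsOn {α β : Type*} {s : ℕ} {F : (ℕ → α) → β}
    (hF : DependsOn F (Set.Iio s)) (a : α) (x : ℕ → α) :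
    F x = F (extendBy a fun i : Fin s => x i) :=
  hF fun _ hi => (extendBy_val_apply_of_lt hi a x).symm

theorem measurable_uncurry_of_dependsOn_Iio {Ω α S : Type*} [MeasurableSpace Ω]
    [MeasurableSpace α] [Countable α] [DiscreteMeasurableSpace α] [MeasurableSpace S]
    {F : Ω → (ℕ → α) → S} {s : ℕ} (hF : ∀ x, Measurable fun ω => F ω x)
    (hdep : ∀ ω, DependsOn (F ω) (Set.Iio s)) : Measurable fun q : Ω × (ℕ → α) => F q.1 q.2 := by
  rcases isEmpty_or_nonempty α with hα | ⟨⟨a⟩⟩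
  · exact measurable_of_empty _
  have h_fin : Measurable fun q : Ω × (Fin s → α) => F q.1 (extendBy a q.2) :=
    measurable_from_prod_countable_left fun z => hF (extendBy a z)
  have h_prefix : Measurable fun q : Ω × (ℕ → α) => (q.1, fun i : Fin s => q.2 i) := by fun_prop
  convert h_fin.comp h_prefix using 1
  funext q
  exact eq_extendBy_of_dependsOn (hdep q.1) a q.2

namespace PropAlgorithm

section Measurability

variable {Ω : Type*} [MeasurableSpace Ω] {n : ℕ} (A : PropAlgorithm Ω) (I : SumInstance n)

theorem measurable_run_prod (t : ℕ) :
    Measurable fun q : Ω × (ℕ → Fin n) => A.run I q.1 q.2 t :=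
  measurable_uncurry_of_dependsOn_Iio (fun x => A.measurable_run I x t)
    fun ω => A.dependsOn_run I ω t

theorem measurable_sampleCount : Measurable fun q : Ω × (ℕ → Fin n) => A.sampleCount I q.1 q.2 :=
  .iSup fun t => (measurable_from_top (f := ((↑) : ℕ → ℝ≥0∞))).comp
    (PropState.measurable_count.comp (A.measurable_run_prod I t))

theorem measurableSet_haltsWithin (s : ℕ) {R : Set ℝ} (hR : MeasurableSet R) :
    MeasurableSet {q : Ω × (ℕ → Fin n) | A.HaltsWithin I s R q.1 q.2} := by
  have h_states : MeasurableSet {σ : PropState | ∃ v ∈ R, σ.out = some v ∧ σ.count ≤ s} := by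
    refine PropState.measurableSet_iff.2 fun c h => ?_
    convert hR.inter (MeasurableSet.const (c ≤ s)) using 1
    ext v
    simp
  convert MeasurableSet.iUnion fun t => A.measurable_run_prod I t h_states using 1
  ext q
  simp [HaltsWithin]

end Measurability

end PropAlgorithm

theorem prod_infinitePi_real_of_dependsOn_Iio {Ω α : Type*} [MeasurableSpace Ω] [Fintype α]
    [MeasurableSpace α] [MeasurableSingletonClass α] (μ : Measure Ω) [IsFiniteMeasure μ]
    (ν : Measure α) [IsProbabilityMeasure ν] {s : ℕ} {P : Ω → (ℕ → α) → Prop}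
    (hP : MeasurableSet {q : Ω × (ℕ → α) | P q.1 q.2})
    (hdep : ∀ ω, DependsOn (P ω) (Set.Iio s)) (a : α) :
    (μ.prod (Measure.infinitePi fun _ => ν)).real {q | P q.1 q.2} =
      ∑ z : Fin s → α, (∏ i, ν.real {z i}) * μ.real {ω | P ω (extendBy a z)} := by
  let sliceMeasure (z : Fin s → α) : ℝ≥0∞ := μ {ω | P ω (extendBy a z)}
  have h_prefix : (Measure.infinitePi fun _ : ℕ => ν).map (fun x (i : Fin s) => x i) =
      Measure.infinitePi fun _ : Fin s => ν :=
    Measure.map_infinitePi_infinitePi_of_inj Fin.val_injective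
  have h_singleton (z : Fin s → α) :
      (Measure.infinitePi fun _ : Fin s => ν) {z} = ∏ i, ν {z i} := by
    rw [Measure.infinitePi_eq_pi, Measure.pi_singleton]
  have h_sum : (μ.prod (Measure.infinitePi fun _ => ν)) {q | P q.1 q.2} =
      ∑ z, sliceMeasure z * ∏ i, ν {z i} := by
    calc (μ.prod (Measure.infinitePi fun _ => ν)) {q | P q.1 q.2}
        = ∫⁻ x, sliceMeasure (fun i => x i) ∂(Measure.infinitePi fun _ : ℕ => ν) := by
          rw [Measure.prod_apply_symm hP]
          refine lintegral_congr fun x => congrArg μ ?_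
          ext ω
          exact (eq_extendBy_of_dependsOn (hdep ω) a x).to_iff
      _ = ∫⁻ z, sliceMeasure z ∂(Measure.infinitePi fun _ : Fin s => ν) := by
          rw [← h_prefix, lintegral_map (Measurable.of_discrete) (by fun_prop)]
      _ = ∑ z, sliceMeasure z * ∏ i, ν {z i} := by simp only [lintegral_fintype, h_singleton]
  rw [measureReal_def, h_sum, ENNReal.toReal_sum fun z _ =>
    ENNReal.mul_ne_top (measure_ne_top _ _) (ENNReal.prod_ne_top fun i _ => measure_ne_top _ _)]
  simp only [ENNReal.toReal_mul, ENNReal.toReal_prod, mul_comm, measureReal_def]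

namespace SumInstance

section SamplingLaw

variable {n : ℕ} (I : SumInstance n)

instance : IsProbabilityMeasure I.sampleSeq := by
  unfold sampleSeq
  infer_instance

theorem nonempty_fin (I : SumInstance n) : Nonempty (Fin n) := by
  by_contra h
  rw [not_nonempty_iff] at h
  simpa using I.total_pos

theorem samplePMF_real_singleton (a : Fin n) :
    I.samplePMF.toMeasure.real {a} = I.w a / I.total := by
  rw [measureReal_def, PMF.toMeasure_apply_singleton _ _ (MeasurableSet.singleton a)]
  exact ENNReal.toReal_ofReal (div_nonneg (I.nonneg a) I.total_pos.le)

/-- The probability that the first `s` samples are the items `z 0, …, z (s - 1)`. -/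
noncomputable def seqProb {s : ℕ} (z : Fin s → Fin n) : ℝ := ∏ i, I.w (z i) / I.total

theorem seqProb_nonneg {s : ℕ} (z : Fin s → Fin n) : 0 ≤ I.seqProb z :=
  Finset.prod_nonneg fun i _ => div_nonneg (I.nonneg (z i)) I.total_pos.le

theorem sum_w_div_total : ∑ a, I.w a / I.total = 1 := by
  rw [← Finset.sum_div]
  exact div_self I.total_pos.ne'

theorem sum_seqProb (s : ℕ) : ∑ z : Fin s → Fin n, I.seqProb z = 1 := by
  simp only [seqProb, ← Fintype.sum_pow (fun a => I.w a / I.total), sum_w_div_total, one_pow]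

theorem prod_sampleSeq_real_of_dependsOn_Iio {Ω : Type*} [MeasurableSpace Ω] (μ : Measure Ω)
    [IsFiniteMeasure μ] {s : ℕ} {P : Ω → (ℕ → Fin n) → Prop}
    (hP : MeasurableSet {q : Ω × (ℕ → Fin n) | P q.1 q.2})
    (hdep : ∀ ω, DependsOn (P ω) (Set.Iio s)) (a : Fin n) :
    (μ.prod I.sampleSeq).real {q | P q.1 q.2} =
      ∑ z : Fin s → Fin n, I.seqProb z * μ.real {ω | P ω (extendBy a z)} := by
  simp only [sampleSeq, prod_infinitePi_real_of_dependsOn_Iio μ I.samplePMF.toMeasure hP hdep a,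
    samplePMF_real_singleton, seqProb]

/-- `J` is obtained from `I` by setting some of the weights to zero. -/
def IsDeletionOf (J I : SumInstance n) : Prop := ∀ a, J.w a = 0 ∨ J.w a = I.w a

/-- The expectation, over a proportional sample from `I`, of the product of the likelihood ratios
of `J` and `J'` to `I`: the quantity that controls the second moment of the likelihood ratio of a
mixture of instances. -/
noncomputable def correlation (I J J' : SumInstance n) : ℝ :=
  ∑ a, J.w a / J.total * (J'.w a / J'.total) / (I.w a / I.total)

variable {I} {J : SumInstance n}

theorem IsDeletionOf.w_eq_of_seqProb_ne_zero (h : J.IsDeletionOf I) {s : ℕ} {z : Fin s → Fin n}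
    (hz : J.seqProb z ≠ 0) (i : Fin s) : J.w (z i) = I.w (z i) := by
  refine (h (z i)).resolve_left fun h0 => hz (Finset.prod_eq_zero (Finset.mem_univ i) ?_)
  rw [h0, zero_div]

theorem IsDeletionOf.seqProb_eq_zero (h : J.IsDeletionOf I) {s : ℕ} {z : Fin s → Fin n}
    (hz : I.seqProb z = 0) : J.seqProb z = 0 := by
  by_contra hJ
  obtain ⟨i, -, hi⟩ := Finset.prod_eq_zero_iff.1 hz
  have hIi : I.w (z i) = 0 := (div_eq_zero_iff.1 hi).resolve_right I.total_pos.ne'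
  refine hJ (Finset.prod_eq_zero (Finset.mem_univ i) ?_)
  rw [h.w_eq_of_seqProb_ne_zero hJ i, hIi, zero_div]

variable (I J) in
theorem sum_seqProb_mul_div (J' : SumInstance n) (s : ℕ) :
    ∑ z : Fin s → Fin n, J.seqProb z * J'.seqProb z / I.seqProb z = correlation I J J' ^ s := by
  rw [correlation, Fintype.sum_pow]
  simp only [seqProb, Finset.prod_mul_distrib, Finset.prod_div_distrib]

end SamplingLaw

/-- The law of the first `s` samples when the instance is chosen uniformly from the family `J`. -/
noncomputable def mixtureProb {n s : ℕ} {ι : Type*} [Fintype ι] (J : ι → SumInstance n)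
    (z : Fin s → Fin n) : ℝ :=
  (∑ f, (J f).seqProb z) / Fintype.card ι

theorem sum_mixtureProb {n : ℕ} {ι : Type*} [Fintype ι] [Nonempty ι] (J : ι → SumInstance n)
    (s : ℕ) : ∑ z : Fin s → Fin n, mixtureProb J z = 1 := by
  simp only [mixtureProb]
  rw [← Finset.sum_div, Finset.sum_comm]
  simp [sum_seqProb]

theorem sum_sq_mixtureProb_div {n : ℕ} {ι : Type*} [Fintype ι] (I : SumInstance n)
    (J : ι → SumInstance n) (s : ℕ) :
    ∑ z : Fin s → Fin n, mixtureProb J z ^ 2 / I.seqProb z =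
      (∑ f, ∑ f', correlation I (J f) (J f') ^ s) / (Fintype.card ι : ℝ) ^ 2 := by
  have h_expand (z : Fin s → Fin n) : mixtureProb J z ^ 2 / I.seqProb z =
      (∑ f, ∑ f', (J f).seqProb z * (J f').seqProb z / I.seqProb z) /
        (Fintype.card ι : ℝ) ^ 2 := by
    simp only [mixtureProb, div_pow, sq (∑ f, (J f).seqProb z), Finset.sum_mul_sum,
      ← Finset.sum_div]
    rw [div_right_comm]
  rw [Fintype.sum_congr _ _ h_expand, ← Finset.sum_div]
  simp only [← sum_seqProb_mul_div]
  exact congrArg (· / _) (Finset.sum_comm.trans (Finset.sum_congr rfl fun f _ => Finset.sum_comm))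

end SumInstance

theorem sum_sq_sub_div {Z : Type*} [Fintype Z] {p q : Z → ℝ} (hp_sum : ∑ z, p z = 1)
    (hq_sum : ∑ z, q z = 1) (hpq : ∀ z, p z = 0 → q z = 0) :
    ∑ z, (q z - p z) ^ 2 / p z = ∑ z, q z ^ 2 / p z - 1 := by
  have h_expand (z : Z) : (q z - p z) ^ 2 / p z = q z ^ 2 / p z - 2 * q z + p z := by
    by_cases hz : p z = 0
    · simp [hz, hpq z hz]
    · field_simp
      ring
  simp only [h_expand, Finset.sum_add_distrib, Finset.sum_sub_distrib, ← Finset.mul_sum,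
    hp_sum, hq_sum]
  ring

theorem sum_mul_le_sum_mul_add_sqrt {Z : Type*} [Fintype Z] {p q v : Z → ℝ} {δ : ℝ}
    (hp : ∀ z, 0 ≤ p z) (hp_sum : ∑ z, p z = 1) (hq_sum : ∑ z, q z = 1)
    (hpq : ∀ z, p z = 0 → q z = 0) (hv : ∀ z, |v z| ≤ 1) (h : ∑ z, q z ^ 2 / p z ≤ 1 + δ) :
    ∑ z, q z * v z ≤ ∑ z, p z * v z + √δ := by
  have h_chiSq : ∑ z, (q z - p z) ^ 2 / p z ≤ δ := by
    linarith [sum_sq_sub_div hp_sum hq_sum hpq]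
  have h_test : ∑ z, p z * v z ^ 2 ≤ 1 := by
    refine hp_sum ▸ Finset.sum_le_sum fun z _ => mul_le_of_le_one_right (hp z) ?_
    exact (sq_le_one_iff_abs_le_one _).2 (hv z)
  have h_cauchySchwarz : (∑ z, (q z - p z) * v z) ^ 2 ≤
      (∑ z, (q z - p z) ^ 2 / p z) * ∑ z, p z * v z ^ 2 := by
    refine Finset.sum_sq_le_sum_mul_sum_of_sq_le_mul _ (fun z _ => ?_) (fun z _ => ?_)
      fun z _ => ?_
    · exact div_nonneg (sq_nonneg _) (hp z)
    · exact mul_nonneg (hp z) (sq_nonneg _)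
    · by_cases hz : p z = 0
      · simp [hz, hpq z hz]
      · exact le_of_eq (by field_simp)
  have h_diff : ∑ z, (q z - p z) * v z ≤ √δ := by
    refine Real.le_sqrt_of_sq_le (h_cauchySchwarz.trans ?_)
    refine (mul_le_of_le_one_right (Finset.sum_nonneg fun z _ => ?_) h_test).trans h_chiSq
    exact div_nonneg (sq_nonneg _) (hp z)
  simp only [sub_mul, Finset.sum_sub_distrib] at h_diff
  linarith

namespace PropAlgorithm

section LeCam

variable {Ω : Type*} [MeasurableSpace Ω] {n : ℕ} {A : PropAlgorithm Ω}
  {μ : Measure Ω} {I : SumInstance n} {s : ℕ} {m ε : ℝ} {R : Set ℝ}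

variable (A μ I s) in
/-- The probability that the algorithm halts within `s` samples with an output in `R` when it is
run on `I` and the first `s` samples happen to be `z`. -/
noncomputable def haltProb (R : Set ℝ) (a : Fin n) (z : Fin s → Fin n) : ℝ :=
  μ.real {ω | A.HaltsWithin I s R ω (extendBy a z)}

theorem seqProb_mul_haltProb_of_isDeletionOf {J : SumInstance n} (hJ : J.IsDeletionOf I)
    (R : Set ℝ) (a : Fin n) (z : Fin s → Fin n) :
    J.seqProb z * A.haltProb μ J s R a z = J.seqProb z * A.haltProb μ I s R a z := by
  by_cases hz : J.seqProb z = 0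
  · rw [hz, zero_mul, zero_mul]
  have hw : ∀ i < s, J.w (extendBy a z i) = I.w (extendBy a z i) := fun i hi => by
    rw [extendBy_apply_val a z ⟨i, hi⟩, hJ.w_eq_of_seqProb_ne_zero hz]
  have h_iff (ω : Ω) : A.HaltsWithin J s R ω (extendBy a z) ↔
      A.HaltsWithin I s R ω (extendBy a z) :=
    ⟨fun h => h.congr (fun _ _ => rfl) hw,
      fun h => h.congr (fun _ _ => rfl) fun i hi => (hw i hi).symm⟩
  simp only [haltProb, h_iff]

theorem ExpectedSamplesLE.mono {m' : ℝ} (h : A.ExpectedSamplesLE μ n m) (hm : m ≤ m') :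
    A.ExpectedSamplesLE μ n m' :=
  fun I => (h I).trans (ENNReal.ofReal_le_ofReal hm)

theorem ExpectedSamplesLE.real_lt_sampleCount_le (h : A.ExpectedSamplesLE μ n m) (hm : 0 ≤ m)
    (I : SumInstance n) (s : ℕ) :
    (μ.prod I.sampleSeq).real {q | s < A.sampleCount I q.1 q.2} ≤ m / (s + 1) := by
  have h_subset : {q : Ω × (ℕ → Fin n) | s < A.sampleCount I q.1 q.2} ⊆
      {q | ((s + 1 : ℕ) : ℝ≥0∞) ≤ A.sampleCount I q.1 q.2} := fun q hq => by
    obtain ⟨t, ht⟩ := (A.lt_sampleCount_iff I).1 hq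
    exact (Nat.cast_le.2 ht).trans (A.count_run_le_sampleCount I t)
  have h_markov : ((s + 1 : ℕ) : ℝ≥0∞) *
      (μ.prod I.sampleSeq) {q | s < A.sampleCount I q.1 q.2} ≤ ENNReal.ofReal m :=
    calc _ ≤ ((s + 1 : ℕ) : ℝ≥0∞) * (μ.prod I.sampleSeq)
            {q | ((s + 1 : ℕ) : ℝ≥0∞) ≤ A.sampleCount I q.1 q.2} := by gcongr
      _ ≤ _ := (mul_meas_ge_le_lintegral (A.measurable_sampleCount I) _).trans (h I)
  have h_real := ENNReal.toReal_mono ENNReal.ofReal_ne_top h_markov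
  rw [ENNReal.toReal_mul, ENNReal.toReal_natCast, ENNReal.toReal_ofReal hm] at h_real
  rw [le_div_iff₀' (by positivity), measureReal_def]
  exact_mod_cast h_real

variable [IsProbabilityMeasure μ]

theorem WorstCaseSamplesLE.expectedSamplesLE (h : A.WorstCaseSamplesLE μ n m) :
    A.ExpectedSamplesLE μ n m := fun I => by
  simpa using lintegral_mono_ae (h I)

theorem Approximates.le_real_succeeds (h : A.Approximates μ n ε) (I : SumInstance n) :
    2 / 3 ≤ (μ.prod I.sampleSeq).real {q | A.Succeeds I ε q.1 q.2} := by
  simpa [measureReal_def] using ENNReal.toReal_mono (measure_ne_top _ _) (h I)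

theorem Approximates.le_real_haltsWithin (h : A.Approximates μ n ε)
    (hcost : A.ExpectedSamplesLE μ n m) (hm : 0 ≤ m) (s : ℕ)
    (hR : Set.Icc ((1 - ε) * I.total) ((1 + ε) * I.total) ⊆ R) :
    2 / 3 - m / (s + 1) ≤ (μ.prod I.sampleSeq).real {q | A.HaltsWithin I s R q.1 q.2} := by
  have h_cover : {q : Ω × (ℕ → Fin n) | A.Succeeds I ε q.1 q.2} ⊆
      {q | A.HaltsWithin I s R q.1 q.2} ∪ {q | s < A.sampleCount I q.1 q.2} :=
    fun q hq => hq.haltsWithin_or_lt_sampleCount hR s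
  have h_union := (measureReal_mono (μ := μ.prod I.sampleSeq) h_cover).trans
    (measureReal_union_le _ _)
  linarith [h.le_real_succeeds I, hcost.real_lt_sampleCount_le hm I s]

theorem Approximates.real_haltsWithin_le (h : A.Approximates μ n ε) (s : ℕ)
    (hR : MeasurableSet R)
    (hdisj : Disjoint (Set.Icc ((1 - ε) * I.total) ((1 + ε) * I.total)) R) :
    (μ.prod I.sampleSeq).real {q | A.HaltsWithin I s R q.1 q.2} ≤ 1 / 3 := by
  have h_subset : {q : Ω × (ℕ → Fin n) | A.Succeeds I ε q.1 q.2} ⊆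
      {q | A.HaltsWithin I s R q.1 q.2}ᶜ := fun q hq => hq.not_haltsWithin hdisj s
  have h_mono := measureReal_mono (μ := μ.prod I.sampleSeq) h_subset
  rw [probReal_compl_eq_one_sub (A.measurableSet_haltsWithin I s hR)] at h_mono
  linarith [h.le_real_succeeds I]

theorem real_haltsWithin_eq_sum (hR : MeasurableSet R) (a : Fin n) :
    (μ.prod I.sampleSeq).real {q | A.HaltsWithin I s R q.1 q.2} =
      ∑ z, I.seqProb z * A.haltProb μ I s R a z :=
  I.prod_sampleSeq_real_of_dependsOn_Iio μ (A.measurableSet_haltsWithin I s hR)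
    (dependsOn_haltsWithin s R) a

theorem sum_mixtureProb_mul {ι : Type*} [Fintype ι] {J : ι → SumInstance n}
    (hJ : ∀ f, (J f).IsDeletionOf I) (hR : MeasurableSet R) (a : Fin n) :
    ∑ z, SumInstance.mixtureProb J z * A.haltProb μ I s R a z =
      (∑ f, (μ.prod (J f).sampleSeq).real {q | A.HaltsWithin (J f) s R q.1 q.2}) /
        Fintype.card ι := by
  simp only [SumInstance.mixtureProb, div_mul_eq_mul_div, ← Finset.sum_div, Finset.sum_mul,
    real_haltsWithin_eq_sum hR a, seqProb_mul_haltProb_of_isDeletionOf (hJ _)]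
  rw [Finset.sum_comm]

theorem Approximates.one_third_le_of_correlation_le {ι : Type*} [Fintype ι] [Nonempty ι]
    {J : ι → SumInstance n} (hJ : ∀ f, (J f).IsDeletionOf I)
    (hsep : ∀ f, (1 + ε) * (J f).total < (1 - ε) * I.total) {δ : ℝ}
    (hcorr : ∑ f, ∑ f', SumInstance.correlation I (J f) (J f') ^ s ≤
      (Fintype.card ι : ℝ) ^ 2 * (1 + δ))
    (h : A.Approximates μ n ε) (hcost : A.ExpectedSamplesLE μ n m) (hm : 0 ≤ m) :
    1 / 3 ≤ m / (s + 1) + √δ := by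
  obtain ⟨a⟩ := I.nonempty_fin
  let R : Set ℝ := Set.Iio ((1 - ε) * I.total)
  let v (z : Fin s → Fin n) : ℝ := A.haltProb μ I s R a z
  have hR : MeasurableSet R := measurableSet_Iio
  have h_base : ∑ z, I.seqProb z * v z ≤ 1 / 3 := by
    rw [← real_haltsWithin_eq_sum hR a]
    exact h.real_haltsWithin_le s hR (Set.disjoint_left.2 fun v hv => not_lt.2 hv.1)
  have h_mixture : 2 / 3 - m / (s + 1) ≤ ∑ z, SumInstance.mixtureProb J z * v z := by
    rw [sum_mixtureProb_mul hJ hR a, le_div_iff₀' (by exact_mod_cast Fintype.card_pos),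
      ← nsmul_eq_mul, ← Finset.card_univ]
    exact Finset.card_nsmul_le_sum _ _ _ fun f _ =>
      h.le_real_haltsWithin hcost hm s fun v hv => hv.2.trans_lt (hsep f)
  have h_zero (z : Fin s → Fin n) (hz : I.seqProb z = 0) : SumInstance.mixtureProb J z = 0 := by
    simp [SumInstance.mixtureProb, (hJ _).seqProb_eq_zero hz]
  have h_chiSq : ∑ z : Fin s → Fin n, SumInstance.mixtureProb J z ^ 2 / I.seqProb z ≤ 1 + δ := by
    rw [SumInstance.sum_sq_mixtureProb_div]
    exact (div_le_iff₀' (by positivity)).2 hcorr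
  have h_close : ∑ z, SumInstance.mixtureProb J z * v z ≤ ∑ z, I.seqProb z * v z + √δ :=
    sum_mul_le_sum_mul_add_sqrt I.seqProb_nonneg (I.sum_seqProb s)
      (SumInstance.sum_mixtureProb J s) h_zero
      (fun z => (abs_of_nonneg measureReal_nonneg).trans_le measureReal_le_one) h_chiSq
  linarith

end LeCam

end PropAlgorithm

theorem sum_exp_sum_le {γ : Type*} [Fintype γ] {φ : γ → ℝ} {v : ℝ} (N : ℕ)
    (hφ : ∀ c, |φ c| ≤ 1) (hφ_sum : ∑ c, φ c = 0) (hφ_sq : ∑ c, φ c ^ 2 ≤ Fintype.card γ * v) :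
    ∑ h : Fin N → γ, Real.exp (∑ i, φ (h i)) ≤ (Fintype.card γ : ℝ) ^ N * Real.exp (N * v) := by
  have h_one : ∑ c, Real.exp (φ c) ≤ Fintype.card γ * Real.exp v :=
    calc ∑ c, Real.exp (φ c)
        ≤ ∑ c, (1 + φ c + φ c ^ 2) := Finset.sum_le_sum fun c _ => by
          linarith [(abs_le.1 (Real.abs_exp_sub_one_sub_id_le (hφ c))).2]
      _ = Fintype.card γ + ∑ c, φ c ^ 2 := by simp [Finset.sum_add_distrib, hφ_sum]
      _ ≤ Fintype.card γ * (v + 1) := by linarith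
      _ ≤ Fintype.card γ * Real.exp v := by gcongr; exact Real.add_one_le_exp v
  simp only [Real.exp_sum, ← Fintype.sum_pow (fun c => Real.exp (φ c)), Real.exp_nat_mul,
    ← mul_pow]
  gcongr

theorem sum_agreement (b : ℕ) :
    ∑ c : Fin b × Fin b, (if c.1 = c.2 then (1 : ℝ) else 0) = b := by
  rw [Fintype.sum_prod_type]
  simp

theorem sum_agreement_sub_inv (b : ℕ) :
    ∑ c : Fin b × Fin b, ((if c.1 = c.2 then 1 else 0) - 1 / (b : ℝ)) = 0 := by
  simp only [Finset.sum_sub_distrib, sum_agreement, Finset.sum_const, Finset.card_univ,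
    Fintype.card_prod, Fintype.card_fin, nsmul_eq_mul, Nat.cast_mul]
  field_simp
  ring

theorem sum_sq_agreement_sub_inv_le (b : ℕ) :
    ∑ c : Fin b × Fin b, ((if c.1 = c.2 then 1 else 0) - 1 / (b : ℝ)) ^ 2 ≤ (b : ℝ) := by
  rcases b.eq_zero_or_pos with rfl | hb
  · simp
  have h_expand (c : Fin b × Fin b) : ((if c.1 = c.2 then 1 else 0) - 1 / (b : ℝ)) ^ 2 =
      (if c.1 = c.2 then 1 else 0) * (1 - 2 / (b : ℝ)) + 1 / (b : ℝ) ^ 2 := by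
    split_ifs <;> ring
  simp only [h_expand, Finset.sum_add_distrib, ← Finset.sum_mul, sum_agreement, Finset.sum_const,
    Finset.card_univ, Fintype.card_prod, Fintype.card_fin, nsmul_eq_mul, Nat.cast_mul]
  field_simp
  linarith

theorem sum_sum_exp_agreements_le (N : ℕ) {b : ℕ} (hb : 0 < b) {θ : ℝ} (hθ₀ : 0 ≤ θ)
    (hθ₁ : θ ≤ 1) :
    ∑ f : Fin N → Fin b, ∑ f' : Fin N → Fin b,
        Real.exp (θ * ∑ i, ((if f i = f' i then 1 else 0) - 1 / (b : ℝ))) ≤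
      ((b : ℝ) ^ N) ^ 2 * Real.exp (N * (θ ^ 2 / b)) := by
  let φ (c : Fin b × Fin b) : ℝ := θ * ((if c.1 = c.2 then 1 else 0) - 1 / (b : ℝ))
  have hb' : (1 : ℝ) ≤ b := by exact_mod_cast hb
  have h_inv : 1 / (b : ℝ) ≤ 1 := (div_le_one₀ (by linarith)).2 hb'
  have h_abs (c : Fin b × Fin b) : |φ c| ≤ 1 := by
    rw [abs_mul, abs_of_nonneg hθ₀]
    refine mul_le_one₀ hθ₁ (abs_nonneg _) (abs_le.2 ?_)
    have : 0 ≤ 1 / (b : ℝ) := by positivity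
    split_ifs <;> constructor <;> linarith
  have h_sum : ∑ c, φ c = 0 := by
    rw [← Finset.mul_sum, sum_agreement_sub_inv, mul_zero]
  have h_sq : ∑ c, φ c ^ 2 ≤ Fintype.card (Fin b × Fin b) * (θ ^ 2 / b) := by
    simp only [φ, mul_pow, ← Finset.mul_sum, Fintype.card_prod, Fintype.card_fin, Nat.cast_mul]
    refine (mul_le_mul_of_nonneg_left (sum_sq_agreement_sub_inv_le b) (sq_nonneg θ)).trans_eq ?_
    field_simp
  calc _ = ∑ h : Fin N → Fin b × Fin b, Real.exp (∑ i, φ (h i)) := by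
        rw [← Fintype.sum_prod_type', ← (Equiv.arrowProdEquivProdArrow _ _ _).sum_comp]
        simp only [φ, Equiv.arrowProdEquivProdArrow_apply, Finset.mul_sum]
    _ ≤ _ := by
        convert sum_exp_sum_le N h_abs h_sum h_sq using 2
        simp [mul_pow, sq]

/-- A symmetric block design of order one on `Fin b`: any two distinct blocks share one point less
than a block shares with itself. The common size is the real number `g`, and the size of the
intersections is the one forced by double counting. -/
structure IsOrderOneDesign {b : ℕ} (K : Fin b → Finset (Fin b)) (g : ℝ) : Prop where
  card_eq : ∀ j, ((K j).card : ℝ) = g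
  card_inter : ∀ j j', ((K j ∩ K j').card : ℝ) = (g ^ 2 - 1) / b + if j = j' then 1 else 0

theorem isOrderOneDesign_singleton (b : ℕ) :
    IsOrderOneDesign (fun j : Fin b => {j}) 1 where
  card_eq j := by simp
  card_inter j j' := by
    rcases eq_or_ne j j' with rfl | h
    · simp
    · simp [Finset.singleton_inter_of_notMem, h]

theorem isOrderOneDesign_compl_singleton (b : ℕ) :
    IsOrderOneDesign (fun j : Fin b => {j}ᶜ) (b - 1) where
  card_eq j := by
    rw [Finset.card_compl, Finset.card_singleton, Fintype.card_fin, Nat.cast_pred j.pos]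
  card_inter j j' := by
    have hb : (b : ℝ) ≠ 0 := by exact_mod_cast j.pos.ne'
    rw [← Finset.compl_union, Finset.card_compl, Fintype.card_fin,
      Nat.cast_sub (by simpa using Finset.card_le_univ ({j} ∪ {j'}))]
    rcases eq_or_ne j j' with rfl | h
    · simp only [Finset.union_self, Finset.card_singleton, Nat.cast_one, if_true]
      field_simp
      ring
    · rw [← Finset.insert_eq, Finset.card_pair h, if_neg h]
      field_simp
      push_cast
      ring

namespace SumInstance

section ExtendByZero

variable {α : Type*} [Fintype α] {n : ℕ} (e : α ↪ Fin n)

theorem sum_extend_zero (f : α → ℝ) : ∑ a, Function.extend e f (0 : Fin n → ℝ) a = ∑ x, f x :=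
  (Fintype.sum_of_injective e e.injective f _
    (fun a ha => Function.extend_apply' f (0 : Fin n → ℝ) a fun ⟨x, hx⟩ => ha ⟨x, hx⟩)
    fun x => (e.injective.extend_apply f (0 : Fin n → ℝ) x).symm).symm

/-- The instance that carries the weights `f` on the range of `e` and weight `0` elsewhere. -/
noncomputable def extendByZero {f : α → ℝ} (hf : ∀ x, 0 ≤ f x) (hf_pos : 0 < ∑ x, f x) :
    SumInstance n where
  w := Function.extend e f 0
  nonneg := Function.extend_nonneg (show 0 ≤ f from hf) le_rfl
  total_pos := by rwa [sum_extend_zero]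

variable {f : α → ℝ} (hf : ∀ x, 0 ≤ f x) (hf_pos : 0 < ∑ x, f x)

theorem extendByZero_w_apply (x : α) : (extendByZero e hf hf_pos).w (e x) = f x :=
  e.injective.extend_apply f (0 : Fin n → ℝ) x

theorem extendByZero_w_eq_zero {a : Fin n} (ha : a ∉ Set.range e) :
    (extendByZero e hf hf_pos).w a = 0 :=
  Function.extend_apply' f (0 : Fin n → ℝ) a ha

theorem total_extendByZero : (extendByZero e hf hf_pos).total = ∑ x, f x :=
  sum_extend_zero e f

theorem isDeletionOf_extendByZero {g : α → ℝ} (hg : ∀ x, 0 ≤ g x) (hg_pos : 0 < ∑ x, g x)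
    (hfg : ∀ x, f x = 0 ∨ f x = g x) :
    (extendByZero e hf hf_pos).IsDeletionOf (extendByZero e hg hg_pos) := fun a => by
  by_cases ha : a ∈ Set.range e
  · obtain ⟨x, rfl⟩ := ha
    simpa only [extendByZero_w_apply] using hfg x
  · exact .inl (extendByZero_w_eq_zero e hf hf_pos ha)

theorem correlation_extendByZero {g g' : α → ℝ} (hg : ∀ x, 0 ≤ g x) (hg_pos : 0 < ∑ x, g x)
    (hg' : ∀ x, 0 ≤ g' x) (hg'_pos : 0 < ∑ x, g' x) :
    correlation (extendByZero e hf hf_pos) (extendByZero e hg hg_pos)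
        (extendByZero e hg' hg'_pos) =
      (∑ x, f x) / ((∑ x, g x) * ∑ x, g' x) * ∑ x, g x * g' x / f x := by
  rw [Finset.mul_sum]
  refine (Fintype.sum_of_injective e e.injective _ _ (fun a ha => ?_) fun x => ?_).symm
  · rw [extendByZero_w_eq_zero e hf hf_pos ha, zero_div, div_zero]
  · simp only [extendByZero_w_apply, total_extendByZero]
    simp only [div_eq_mul_inv, mul_inv, inv_inv]
    ring

end ExtendByZero

end SumInstance

section BlockWeight

variable {N b : ℕ} {H : ℝ} {K K' : Fin N → Finset (Fin b)}

/-- The weights of a heavy item of weight `H` and of `N` blocks of `b` items each, where the items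
of the `i`-th block that lie in `K i` have weight `1` and the others have weight `0`. -/
def blockWeight (H : ℝ) (K : Fin N → Finset (Fin b)) : Option (Fin N × Fin b) → ℝ
  | none => H
  | some (i, j) => if j ∈ K i then 1 else 0

theorem blockWeight_nonneg (hH : 0 ≤ H) (x : Option (Fin N × Fin b)) : 0 ≤ blockWeight H K x := by
  obtain _ | ⟨i, j⟩ := x
  · exact hH
  · exact ite_nonneg zero_le_one le_rfl

theorem sum_blockWeight : ∑ x, blockWeight H K x = H + ∑ i, ((K i).card : ℝ) := by
  rw [Fintype.sum_option, Fintype.sum_prod_type]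
  simp [blockWeight]

theorem blockWeight_eq_zero_or_eq_univ (x : Option (Fin N × Fin b)) :
    blockWeight H K x = 0 ∨ blockWeight H K x = blockWeight H (fun _ => Finset.univ) x := by
  obtain _ | ⟨i, j⟩ := x
  · exact .inr rfl
  · simp only [blockWeight, Finset.mem_univ, if_true]
    split_ifs <;> simp

theorem blockWeight_mul_div_univ (x : Option (Fin N × Fin b)) :
    blockWeight H K x * blockWeight H K' x / blockWeight H (fun _ => Finset.univ) x =
      blockWeight H (fun i => K i ∩ K' i) x := by
  obtain _ | ⟨i, j⟩ := x
  · exact mul_self_div_self H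
  · simp [blockWeight, ← ite_and, and_comm]

end BlockWeight

section RandomBlocks

variable {N b : ℕ} {H g : ℝ} {K : Fin b → Finset (Fin b)}

theorem IsOrderOneDesign.sum_blockWeight_comp (hK : IsOrderOneDesign K g) (f : Fin N → Fin b) :
    ∑ x, blockWeight H (fun i => K (f i)) x = H + N * g := by
  rw [sum_blockWeight]
  simp [hK.card_eq]

theorem IsOrderOneDesign.sum_blockWeight_comp_mul_div_univ (hK : IsOrderOneDesign K g)
    (f f' : Fin N → Fin b) :
    ∑ x, blockWeight H (fun i => K (f i)) x * blockWeight H (fun i => K (f' i)) x /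
        blockWeight H (fun _ => Finset.univ) x =
      H + N * (g ^ 2 / b) + ∑ i, ((if f i = f' i then 1 else 0) - 1 / (b : ℝ)) := by
  simp only [blockWeight_mul_div_univ, sum_blockWeight, hK.card_inter,
    Finset.sum_add_distrib, Finset.sum_sub_distrib, Finset.sum_const, Finset.card_univ,
    Fintype.card_fin, nsmul_eq_mul]
  ring

theorem sum_sum_pow_agreements_le {s : ℕ} (hb : 0 < b) (hH : 0 ≤ H) (hW : 0 < H + N * g)
    (hθ : s * (H + N * b) / (H + N * g) ^ 2 ≤ 1)
    (hr : ∀ f f' : Fin N → Fin b,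
      0 ≤ H + N * (g ^ 2 / b) + ∑ i, ((if f i = f' i then 1 else 0) - 1 / (b : ℝ))) :
    ∑ f : Fin N → Fin b, ∑ f' : Fin N → Fin b,
        ((H + N * b) / ((H + N * g) * (H + N * g)) * (H + N * (g ^ 2 / b) +
          ∑ i, ((if f i = f' i then 1 else 0) - 1 / (b : ℝ)))) ^ s ≤
      ((b : ℝ) ^ N) ^ 2 * Real.exp (s * (H * N * (b - g) ^ 2 / (b * (H + N * g) ^ 2)) +
        N * ((s * (H + N * b) / (H + N * g) ^ 2) ^ 2 / b)) := by
  have : (0 : ℝ) < b := by exact_mod_cast hb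
  have : 0 ≤ H + N * b := by positivity
  set θ := s * (H + N * b) / (H + N * g) ^ 2 with hθ_def
  set κ := H * N * (b - g) ^ 2 / (b * (H + N * g) ^ 2) with hκ_def
  have h_split (r : ℝ) : s * ((H + N * b) / ((H + N * g) * (H + N * g)) *
      (H + N * (g ^ 2 / b) + r) - 1) = s * κ + θ * r := by
    rw [hθ_def, hκ_def]
    field_simp
    ring
  have h_pow (r : ℝ) (hr : 0 ≤ H + N * (g ^ 2 / b) + r) :
      ((H + N * b) / ((H + N * g) * (H + N * g)) * (H + N * (g ^ 2 / b) + r)) ^ s ≤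
        Real.exp (s * κ) * Real.exp (θ * r) := by
    rw [← Real.exp_add, ← h_split, Real.exp_nat_mul]
    refine pow_le_pow_left₀ (by positivity) ?_ s
    linarith [Real.add_one_le_exp ((H + N * b) / ((H + N * g) * (H + N * g)) *
      (H + N * (g ^ 2 / b) + r) - 1)]
  calc _ ≤ ∑ f : Fin N → Fin b, ∑ f' : Fin N → Fin b, Real.exp (s * κ) *
          Real.exp (θ * ∑ i, ((if f i = f' i then 1 else 0) - 1 / (b : ℝ))) :=
        Finset.sum_le_sum fun f _ => Finset.sum_le_sum fun f' _ => h_pow _ (hr f f')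
    _ ≤ Real.exp (s * κ) * (((b : ℝ) ^ N) ^ 2 * Real.exp (N * (θ ^ 2 / b))) := by
        simp only [← Finset.mul_sum]
        gcongr
        exact sum_sum_exp_agreements_le N hb (by positivity) hθ
    _ = _ := by rw [Real.exp_add]; ring

theorem IsOrderOneDesign.exists_sum_correlation_pow_le {n s : ℕ} (hK : IsOrderOneDesign K g)
    (hb : 0 < b) (hn : 1 + N * b ≤ n) (hH : 0 ≤ H) (hW : 0 < H + N * g)
    (hθ : s * (H + N * b) / (H + N * g) ^ 2 ≤ 1) :
    ∃ (I : SumInstance n) (J : (Fin N → Fin b) → SumInstance n),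
      (∀ f, (J f).IsDeletionOf I) ∧ I.total = H + N * b ∧ (∀ f, (J f).total = H + N * g) ∧
      ∑ f, ∑ f', SumInstance.correlation I (J f) (J f') ^ s ≤
        ((b : ℝ) ^ N) ^ 2 * Real.exp (s * (H * N * (b - g) ^ 2 / (b * (H + N * g) ^ 2)) +
          N * ((s * (H + N * b) / (H + N * g) ^ 2) ^ 2 / b)) := by
  obtain ⟨e⟩ : Nonempty (Option (Fin N × Fin b) ↪ Fin n) :=
    Function.Embedding.nonempty_of_card_le (by simpa [add_comm] using hn)
  have h_sum_univ : ∑ x, blockWeight (N := N) (b := b) H (fun _ => Finset.univ) x = H + N * b := by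
    rw [sum_blockWeight]
    simp
  have h_pos : 0 < H + N * b := by
    rcases N.eq_zero_or_pos with rfl | hN
    · simpa using hW
    · positivity
  refine ⟨.extendByZero e (blockWeight_nonneg hH) (h_sum_univ ▸ h_pos),
    fun f => .extendByZero e (blockWeight_nonneg (K := fun i => K (f i)) hH)
      ((hK.sum_blockWeight_comp f).symm ▸ hW), fun f => ?_, ?_, fun f => ?_, ?_⟩
  · exact SumInstance.isDeletionOf_extendByZero e _ _ _ _ blockWeight_eq_zero_or_eq_univ
  · exact (SumInstance.total_extendByZero e _ _).trans h_sum_univ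
  · exact (SumInstance.total_extendByZero e _ _).trans (hK.sum_blockWeight_comp f)
  · simp only [SumInstance.correlation_extendByZero, hK.sum_blockWeight_comp, h_sum_univ,
      hK.sum_blockWeight_comp_mul_div_univ]
    refine sum_sum_pow_agreements_le hb hH hW hθ fun f f' => ?_
    rw [← hK.sum_blockWeight_comp_mul_div_univ]
    exact Finset.sum_nonneg fun x _ => div_nonneg
      (mul_nonneg (blockWeight_nonneg hH x) (blockWeight_nonneg hH x)) (blockWeight_nonneg hH x)

end RandomBlocks

theorem exists_mul_le_and_half_le_mul {n b : ℕ} (hb : 0 < b) (h : 2 * b ≤ n) :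
    ∃ N : ℕ, 1 + N * b ≤ n ∧ (n : ℝ) / 2 ≤ N * b := by
  have h_div := Nat.div_add_mod' (n - 1) b
  have h_mod := Nat.mod_lt (n - 1) hb
  refine ⟨(n - 1) / b, by omega, ?_⟩
  have h_le : n ≤ (n - 1) / b * b * 2 := by omega
  rw [div_le_iff₀ two_pos]
  exact_mod_cast h_le

theorem exists_blockSize {r : ℝ} {k : ℕ} (hr : 8 ≤ r) (hk : 2 ≤ k) :
    ∃ b : ℕ, 2 ≤ b ∧ b ≤ k ∧ 2 * b ≤ r ∧ (b = k ∨ r ≤ 4 * b) := by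
  rcases le_or_gt (2 * (k : ℝ)) r with h | h
  · exact ⟨k, hk, le_rfl, h, .inl rfl⟩
  · have h_le : (⌊r / 2⌋₊ : ℝ) ≤ r / 2 := Nat.floor_le (by linarith)
    have h_lt : r / 2 < ⌊r / 2⌋₊ + 1 := Nat.lt_floor_add_one _
    refine ⟨⌊r / 2⌋₊, Nat.le_floor (by norm_num; linarith), ?_, by linarith, .inr (by linarith)⟩
    have : (⌊r / 2⌋₊ : ℝ) ≤ k := by linarith
    exact_mod_cast this

namespace PropAlgorithm

section LowerBound

variable {Ω : Type*} [MeasurableSpace Ω] {μ : Measure Ω} [IsProbabilityMeasure μ]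
  {A : PropAlgorithm Ω} {n s : ℕ} {m ε : ℝ}

theorem ExpectedSamplesLE.not_approximates_of_design {N b : ℕ} {H g : ℝ}
    {K : Fin b → Finset (Fin b)} (hK : IsOrderOneDesign K g) (hb : 0 < b) (hn : 1 + N * b ≤ n)
    (hH : 0 ≤ H) (hW : 0 < H + N * g)
    (hsep : (1 + ε) * (H + N * g) < (1 - ε) * (H + N * b))
    (hθ : s * (H + N * b) / (H + N * g) ^ 2 ≤ 1)
    (hsmall : s * (H * N * (b - g) ^ 2 / (b * (H + N * g) ^ 2)) +
      N * ((s * (H + N * b) / (H + N * g) ^ 2) ^ 2 / b) ≤ 1 / 30)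
    (hm : 0 ≤ m) (hms : 10 * m ≤ s + 1) (hcost : A.ExpectedSamplesLE μ n m) :
    ¬ A.Approximates μ n ε := fun h => by
  obtain ⟨I, J, hJ, hI_total, hJ_total, h_sum⟩ := hK.exists_sum_correlation_pow_le hb hn hH hW hθ
  have h_exp : Real.exp (1 / 30) ≤ 1 + 1 / 25 := by
    linarith [(abs_le.1 (Real.abs_exp_sub_one_sub_id_le
      (show |(1 / 30 : ℝ)| ≤ 1 by norm_num [abs_of_pos]))).2]
  have h_corr : ∑ f, ∑ f', SumInstance.correlation I (J f) (J f') ^ s ≤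
      (Fintype.card (Fin N → Fin b) : ℝ) ^ 2 * (1 + 1 / 25) := by
    refine h_sum.trans ?_
    simp only [Fintype.card_pi_const, Fintype.card_fin, Nat.cast_pow]
    gcongr
    exact (Real.exp_le_exp.2 hsmall).trans h_exp
  have : Nonempty (Fin b) := ⟨⟨0, hb⟩⟩
  have h_third : 1 / 3 ≤ m / (s + 1) + √(1 / 25) :=
    h.one_third_le_of_correlation_le hJ (fun f => by rwa [hJ_total, hI_total]) h_corr hcost hm
  rw [show (1 / 25 : ℝ) = (1 / 5) ^ 2 by norm_num, Real.sqrt_sq (by norm_num)] at h_third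
  have h_markov : m / (s + 1) ≤ 1 / 10 := (div_le_iff₀ (by positivity)).2 (by linarith)
  linarith

theorem ExpectedSamplesLE.not_approximates_of_singletons {N b : ℕ} (hb : 0 < b) (hN : 0 < N)
    (hn : 1 + N * b ≤ n) (hsep : 1 + ε < (1 - ε) * b) (hθ : s * b ≤ N)
    (hsmall : (s * b : ℝ) ^ 2 / (N * b) ≤ 1 / 30)
    (hm : 0 ≤ m) (hms : 10 * m ≤ s + 1) (hcost : A.ExpectedSamplesLE μ n m) :
    ¬ A.Approximates μ n ε := by
  have hN' : (0 : ℝ) < N := by exact_mod_cast hN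
  have hθ_eq : (s * (0 + N * b) / (0 + N * 1) ^ 2 : ℝ) = s * b / N := by
    rw [zero_add, zero_add, mul_one]
    field_simp
  refine hcost.not_approximates_of_design (isOrderOneDesign_singleton b) (s := s) hb hn le_rfl
    (by simpa using hN) ?_ ?_ ?_ hm hms
  · linarith [mul_lt_mul_of_pos_right hsep hN']
  · rw [hθ_eq, div_le_one hN']
    exact_mod_cast hθ
  · rw [hθ_eq]
    convert hsmall using 1
    field_simp
    ring

theorem ExpectedSamplesLE.not_approximates_of_complements {N b : ℕ} {k : ℝ} (hb : 0 < b)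
    (hN : 0 < N) (hn : 1 + N * b ≤ n) (hbk : b ≤ k) (hk : 1 < k) (hε : 0 < ε)
    (hsep : 2 * ε * k ≤ 1) (hθ : s * k ≤ N * (k - 1) ^ 2)
    (hsmall : s * (k - b) / (b * (k - 1) ^ 2) + (s * k / (k - 1) ^ 2) ^ 2 / (N * b) ≤ 1 / 30)
    (hm : 0 ≤ m) (hms : 10 * m ≤ s + 1) (hcost : A.ExpectedSamplesLE μ n m) :
    ¬ A.Approximates μ n ε := by
  have hN' : (0 : ℝ) < N := by exact_mod_cast hN
  have hk' : 0 < k - 1 := sub_pos.2 hk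
  have h_full : N * (k - b) + N * b = N * k := by ring
  have h_deleted : N * (k - b) + N * (b - 1) = N * (k - 1) := by ring
  have hθ_eq : s * (N * k) / (N * (k - 1)) ^ 2 = s * k / (N * (k - 1) ^ 2) := by
    field_simp
  refine hcost.not_approximates_of_design (isOrderOneDesign_compl_singleton b) (s := s) hb hn
    (mul_nonneg hN'.le (sub_nonneg.2 hbk)) (h_deleted ▸ mul_pos hN' hk') ?_ ?_ ?_ hm hms
  · rw [h_full, h_deleted]
    nlinarith
  · rw [h_full, h_deleted, hθ_eq]
    exact div_le_one_of_le₀ hθ (by positivity)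
  · rw [h_full, h_deleted, hθ_eq]
    convert hsmall using 1
    field_simp
    ring

theorem ExpectedSamplesLE.not_approximates_of_mul_le_sqrt {b : ℕ} (hb : 0 < b)
    (hbn : 2 * b ^ 2 ≤ n) (hsep : 1 + ε < (1 - ε) * b) (hm : 0 ≤ m)
    (hmb : m * b ≤ √n / 10000) (hcost : A.ExpectedSamplesLE μ n m) :
    ¬ A.Approximates μ n ε := by
  obtain ⟨s, hs_le, hms⟩ := (⟨_, Nat.floor_le (by positivity), (Nat.lt_floor_add_one _).le⟩ :
    ∃ s : ℕ, (s : ℝ) ≤ 10 * m ∧ 10 * m ≤ s + 1)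
  have hb' : (0 : ℝ) < b := by exact_mod_cast hb
  have hs : s * b ≤ √(n : ℝ) / 1000 := by nlinarith
  have hbn' : 2 * (b : ℝ) ^ 2 ≤ n := by exact_mod_cast hbn
  have hn : (0 : ℝ) < n := by nlinarith
  have h_sq : √(n : ℝ) ^ 2 = n := Real.sq_sqrt hn.le
  have hb_sqrt : (b : ℝ) ≤ √n := Real.le_sqrt_of_sq_le (by nlinarith)
  obtain ⟨N, hNn, h_half⟩ := exists_mul_le_and_half_le_mul hb (show 2 * b ≤ n by nlinarith)
  have hN : (0 : ℝ) < N := pos_of_mul_pos_left (by linarith) hb'.le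
  have hθ : s * (b : ℝ) ≤ N := le_of_mul_le_mul_right (by nlinarith) hb'
  have hsmall : (s * b : ℝ) ^ 2 / (N * b) ≤ 1 / 30 := by
    rw [div_le_iff₀ (by positivity)]
    nlinarith [pow_le_pow_left₀ (by positivity) hs 2]
  exact hcost.not_approximates_of_singletons hb (by exact_mod_cast hN) hNn hsep
    (by exact_mod_cast hθ) hsmall hm hms

theorem ExpectedSamplesLE.not_approximates_of_le_sqrt_mul {k : ℕ} (hn : 64 ≤ n) (hk : 2 ≤ k)
    (hε : 0 < ε) (hsep : 2 * ε * k ≤ 1) (hm : 0 ≤ m)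
    (hmk : m ≤ √n * k / 10000) (hcost : A.ExpectedSamplesLE μ n m) :
    ¬ A.Approximates μ n ε := by
  obtain ⟨s, hs_le, hms⟩ := (⟨_, Nat.floor_le (by positivity), (Nat.lt_floor_add_one _).le⟩ :
    ∃ s : ℕ, (s : ℝ) ≤ 10 * m ∧ 10 * m ≤ s + 1)
  have hs : s ≤ √(n : ℝ) * k / 1000 := by linarith
  have hk' : (2 : ℝ) ≤ k := by exact_mod_cast hk
  have hn' : (64 : ℝ) ≤ n := by exact_mod_cast hn
  have h_sq : √(n : ℝ) ^ 2 = n := Real.sq_sqrt n.cast_nonneg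
  have h_sqrt : 8 ≤ √(n : ℝ) := Real.le_sqrt_of_sq_le (by linarith)
  obtain ⟨b, hb, hbk, hb_sqrt, h_trunc⟩ := exists_blockSize h_sqrt hk
  have hb' : (2 : ℝ) ≤ b := by exact_mod_cast hb
  have hbk' : (b : ℝ) ≤ k := by exact_mod_cast hbk
  have h_two_mul : 2 * b ≤ n := by
    have : 2 * (b : ℝ) ≤ n := by nlinarith
    exact_mod_cast this
  obtain ⟨N, hNn, h_half⟩ := exists_mul_le_and_half_le_mul (show 0 < b by omega) h_two_mul
  have hN : √(n : ℝ) ≤ N := le_of_mul_le_mul_right (by nlinarith) (show (0 : ℝ) < b by linarith)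
  have hk_pos : (0 : ℝ) < (k - 1) ^ 2 := pow_pos (by linarith) 2
  have hsk : s * k ≤ √n / 250 * (k - 1) ^ 2 := by
    have : (k : ℝ) ^ 2 ≤ 4 * (k - 1) ^ 2 := by nlinarith
    nlinarith
  have h_heavy : s * (k - b) / (b * (k - 1) ^ 2) ≤ (2 / 125 : ℝ) := by
    rcases h_trunc with rfl | h_trunc
    · norm_num
    · rw [div_le_iff₀ (by positivity)]
      nlinarith [mul_nonneg s.cast_nonneg (show (0 : ℝ) ≤ b by linarith)]
  have h_blocks : (s * k / (k - 1) ^ 2) ^ 2 / (N * b) ≤ (2 / 250 ^ 2 : ℝ) := by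
    have h_sq_le := pow_le_pow_left₀ (by positivity) ((div_le_iff₀ hk_pos).2 hsk) 2
    rw [div_le_iff₀ (mul_pos (by linarith) (by linarith))]
    linarith [div_pow (√(n : ℝ)) 250 2]
  refine hcost.not_approximates_of_complements (by omega) ?_ hNn hbk' (by linarith) hε hsep ?_
    (by linarith) hm hms
  · exact_mod_cast (by linarith : (0 : ℝ) < N)
  · nlinarith

end LowerBound

end PropAlgorithm

theorem exists_nat_mul_le_one_and_inv_le {ε : ℝ} (hε : 0 < ε) (hε' : ε ≤ 1 / 4) :
    ∃ k : ℕ, 2 ≤ k ∧ 2 * ε * k ≤ 1 ∧ 1 / ε ≤ 3 * k := by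
  have hk_le : (⌊1 / (2 * ε)⌋₊ : ℝ) ≤ 1 / (2 * ε) := Nat.floor_le (by positivity)
  have hk_lt : 1 / (2 * ε) < ⌊1 / (2 * ε)⌋₊ + 1 := Nat.lt_floor_add_one _
  have hk : 2 ≤ ⌊1 / (2 * ε)⌋₊ := Nat.le_floor (by
    rw [Nat.cast_ofNat, le_div_iff₀ (by positivity)]
    linarith)
  have hk' : (2 : ℝ) ≤ ⌊1 / (2 * ε)⌋₊ := by exact_mod_cast hk
  refine ⟨_, hk, ?_, ?_⟩
  · rwa [le_div_iff₀' (by positivity)] at hk_le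
  · have h_double : 1 / ε = 2 * (1 / (2 * ε)) := by field_simp
    linarith

theorem PropAlgorithm.exists_not_approximates_of_expectedSamplesLE {ε₀ : ℝ} (hε₀ : ε₀ < 1) :
    ∃ c > 0, ∃ n₀ : ℕ, ∀ n ≥ n₀, ∀ ε : ℝ, 0 < ε → ε ≤ ε₀ →
      ∀ (Ω : Type*) [MeasurableSpace Ω] (μ : Measure Ω) [IsProbabilityMeasure μ]
        (A : PropAlgorithm Ω), A.ExpectedSamplesLE μ n (c * (√n / ε)) → ¬ A.Approximates μ n ε := by
  obtain ⟨b, hb⟩ := exists_nat_gt (max 1 ((1 + ε₀) / (1 - ε₀)))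
  obtain ⟨hb_one, hb_sep⟩ := max_lt_iff.1 hb
  rw [div_lt_iff₀' (sub_pos.2 hε₀)] at hb_sep
  refine ⟨1 / (40000 * b), by positivity, max 64 (2 * b ^ 2),
    fun n hn ε hε hεε₀ Ω _ μ _ A hcost => ?_⟩
  obtain ⟨hn_64, hbn⟩ := max_le_iff.1 hn
  have hm : 1 / (40000 * b) * (√n / ε) * b = √n * (1 / ε) / 40000 := by field_simp
  rcases le_or_gt (1 / 4) ε with h | h
  · have h_inv : 1 / ε ≤ 4 := by
      rw [div_le_iff₀ hε]
      linarith
    refine hcost.not_approximates_of_mul_le_sqrt (b := b) (by exact_mod_cast one_pos.trans hb_one)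
      hbn ?_ (by positivity) ?_
    · nlinarith
    · rw [hm]
      nlinarith [Real.sqrt_nonneg (n : ℝ)]
  · obtain ⟨k, hk, hk_le, h_inv⟩ := exists_nat_mul_le_one_and_inv_le hε h.le
    refine hcost.not_approximates_of_le_sqrt_mul hn_64 hk hε hk_le (by positivity) ?_
    calc 1 / (40000 * b) * (√n / ε) = √n * (1 / ε) / 40000 / b := by field_simp
      _ ≤ √n * (3 * k) / 40000 / 1 := by gcongr
      _ ≤ √n * k / 10000 := by nlinarith [mul_nonneg (Real.sqrt_nonneg (n : ℝ)) k.cast_nonneg]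

theorem mainTheorem7_general (ε₀ : ℝ) (hε₀ : ε₀ < 1) :
    ∃ c > 0, ∀ m : ℕ → ℝ → ℝ,
      IsBigOWith c (atTop ×ˢ 𝓟 (Set.Ioc 0 ε₀)) (fun p : ℕ × ℝ => m p.1 p.2)
        (fun p : ℕ × ℝ => √(p.1 : ℝ) / p.2) →
      ∃ n₀ : ℕ, ∀ n : ℕ, n₀ ≤ n → ∀ ε : ℝ, 0 < ε → ε ≤ ε₀ →
        ∀ (Ω : Type*) [MeasurableSpace Ω] (μ : Measure Ω) [IsProbabilityMeasure μ]
          (A : PropAlgorithm Ω),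
          ¬ (A.WorstCaseSamplesLE μ n (m n ε) ∧ A.Approximates μ n ε) ∧
          ¬ (A.ExpectedSamplesLE μ n (m n ε) ∧ A.Approximates μ n ε) := by
  obtain ⟨c, hc, n₁, h⟩ := PropAlgorithm.exists_not_approximates_of_expectedSamplesLE hε₀
  refine ⟨c, hc, fun m hm => ?_⟩
  obtain ⟨n₂, h_bound⟩ := eventually_atTop.1 (eventually_prod_principal_iff.1 hm.bound)
  refine ⟨max n₁ n₂, fun n hn ε hε hεε₀ Ω _ μ _ A => ?_⟩
  obtain ⟨hn₁, hn₂⟩ := max_le_iff.1 hn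
  have h_le : m n ε ≤ c * (√n / ε) := by
    simpa only [Real.norm_of_nonneg (show 0 ≤ √(n : ℝ) / ε by positivity)] using
      (Real.le_norm_self _).trans (h_bound n hn₂ ε ⟨hε, hεε₀⟩)
  have h_expected (hcost : A.ExpectedSamplesLE μ n (m n ε)) : ¬ A.Approximates μ n ε :=
    h n hn₁ ε hε hεε₀ Ω μ A (hcost.mono h_le)
  exact ⟨fun hA => h_expected hA.1.expectedSamplesLE hA.2, fun hA => h_expected hA.1 hA.2⟩

/-- Let `ε₀ < 1` and let `m (n, ε) = o(√n / ε)` as `n → ∞`, uniformly over `0 < ε ≤ ε₀`. Then for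
all sufficiently large `n` and all `0 < ε ≤ ε₀`, no algorithm, even one designed for these values
of `n` and `ε`, draws at most `m (n, ε)` samples (in the worst case, or just in expectation) on
every instance of size `n` and returns a `(1 ± ε)`-approximation of the total weight with
probability at least `2/3` on every such instance. -/
theorem mainTheorem7 (ε₀ : ℝ) (hε₀ : ε₀ < 1) (m : ℕ → ℝ → ℝ)
    (hm : (fun p : ℕ × ℝ => m p.1 p.2)
      =o[atTop ×ˢ 𝓟 (Set.Ioc 0 ε₀)] (fun p : ℕ × ℝ => √(p.1 : ℝ) / p.2)) :
    ∃ n₀ : ℕ, ∀ n : ℕ, n₀ ≤ n → ∀ ε : ℝ, 0 < ε → ε ≤ ε₀ →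
      ∀ (Ω : Type*) [MeasurableSpace Ω] (μ : Measure Ω) [IsProbabilityMeasure μ]
        (A : PropAlgorithm Ω),
        ¬ (A.WorstCaseSamplesLE μ n (m n ε) ∧ A.Approximates μ n ε) ∧
        ¬ (A.ExpectedSamplesLE μ n (m n ε) ∧ A.Approximates μ n ε) := by
  obtain ⟨c, hc, h⟩ := mainTheorem7_general ε₀ hε₀
  exact h m (hm.forall_isBigOWith hc)
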